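/- Let $0<\lambda<\mu$ and consider a single-server, infinite-buffer, first-in-first-out M/M/1 queue in equilibrium, viewed from its customers: the customers are numbered by $n\in\mathbb{Z}$ in the order of their arrival times $A_n$, the inter-arrival times $\tau_n=A_{n+1}-A_n$ are $\mathrm{Exp}(\lambda)$, the service times $\sigma_n$ are $\mathrm{Exp}(\mu)$, all these variables are independent, and the departure times $D_n$ are those of the stationary regime, i.e. $D_n$ is the limit, as $k\to\infty$, of the departure time of customer $n$ from the queue that starts empty with customer $n-k$. Let $Q_t=\#\{n: A_n\le t<D_n\}$ be the number of customers in the system at time $t$. A busy period is a maximal time interval on which $Q_t>0$, and its length $|B|$ is the number of customers that arrive (and are served) during it. For a customer $*$ (any fixed $n\in\mathbb{Z}$), let $B$ be the busy period to which it belongs and let $\mathfrak{E}_{\mathrm{m}}$ be the event that $|B|>2$ and that $*$ is neither the first nor the last customer of $B$. Then $\mathfrak{E}_{\mathrm{m}}$ is an event (up to a null set) of positive probability, and the Laplace transform of the conditional law of the service time $\sigma_*$ given $\mathfrak{E}_{\mathrm{m}}$ is $$\mathbb{E}\left[e^{-s\sigma_*}\mid \mathfrak{E}_{\mathrm{m}}\right]=\frac{(2\mu+s)(\mu+\lambda)}{2(\mu+s)(\mu+\lambda+s)},\qquad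 s\in\mathbb{C},\ \operatorname{Re}(s)\ge 0 .$$ -/

import Mathlib

open MeasureTheory ProbabilityTheory
open scoped ENNReal

noncomputable section

namespace MM1

/-- Departure time of customer `m + k` from a single-server FIFO queue whose first customer is
customer `m`, who finds the system empty. Customer `i` arrives at time `A i` and has service time
`σ i`; the service of a customer begins at the later of its own arrival and the departure of the
previous customer. -/
def departureFrom (A σ : ℤ → ℝ) (m : ℤ) : ℕ → ℝ
  | 0 => A m + σ m
  | k + 1 => max (A (m + (k + 1 : ℕ))) (departureFrom A σ m k) + σ (m + (k + 1 : ℕ))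

/-- Departure time of customer `n` in equilibrium: the limit, as `k → ∞`, of its departure time from
the queue which starts empty with customer `n - k`. The sequence is nondecreasing in `k` when the
service times are nonnegative, so its limit is its supremum. In a stable queue the supremum is almost
surely finite, and it is the stationary regime of the queue. -/
def departure (A σ : ℤ → ℝ) (n : ℤ) : ℝ :=
  ⨆ k : ℕ, departureFrom A σ (n - k) k

/-- The queue length at time `t`: the number of customers in service or in the buffer. -/
def queueLength (A σ : ℤ → ℝ) (t : ℝ) : ℕ∞ :=
  {n : ℤ | A n ≤ t ∧ t < departure A σ n}.encard

/-- The busy period of customer `n`: the maximal time interval that contains the arrival time of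
customer `n` and on which the queue length is positive. -/
def busyPeriod (A σ : ℤ → ℝ) (n : ℤ) : Set ℝ :=
  Set.ordConnectedComponent {t : ℝ | 0 < queueLength A σ t} (A n)

/-- The customers of the busy period of customer `n`. -/
def busyCustomers (A σ : ℤ → ℝ) (n : ℤ) : Set ℤ :=
  {m : ℤ | A m ∈ busyPeriod A σ n}

/-- The length of the busy period of customer `n`: the number of its customers. -/
def busyLength (A σ : ℤ → ℝ) (n : ℤ) : ℕ∞ :=
  (busyCustomers A σ n).encard

/-- Customer `n` is in the middle of its busy period: the busy period has more than two customers,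
and `n` is neither the first nor the last of them. -/
def InMiddle (A σ : ℤ → ℝ) (n : ℤ) : Prop :=
  2 < busyLength A σ n ∧
    ¬ IsLeast (busyCustomers A σ n) n ∧ ¬ IsGreatest (busyCustomers A σ n) n

/-- The primitive data of an M/M/1 queue with arrival intensity `lam` and service parameter `mu`, as
seen by its customers: the interarrival times `A (n + 1) - A n` are exponential of parameter `lam`,
the service times `σ n` are exponential of parameter `mu`, and all of them are independent. -/
structure IsMM1 {Ω : Type*} [MeasurableSpace Ω] (P : Measure Ω) (lam mu : ℝ)
    (A σ : ℤ → Ω → ℝ) : Prop where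
  measurable_arrival : ∀ n, Measurable (A n)
  measurable_service : ∀ n, Measurable (σ n)
  law_interarrival : ∀ n, P.map (fun ω => A (n + 1) ω - A n ω) = expMeasure lam
  law_service : ∀ n, P.map (σ n) = expMeasure mu
  indep : iIndepFun (Sum.elim (fun n ω => A (n + 1) ω - A n ω) σ : ℤ ⊕ ℤ → Ω → ℝ) P

/-- The event that customer `n` is in the middle of its busy period. -/
def middleEvent {Ω : Type*} (A σ : ℤ → Ω → ℝ) (n : ℤ) : Set Ω :=
  {ω | InMiddle (fun i => A i ω) (fun i => σ i ω) n}

end MM1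

end

noncomputable section

namespace MM1

open Set Finset

/-! Let U be the departure time of customer n - 1 minus the arrival time of customer n, let σ be the
service time of customer n and τ the next interarrival time. Unrolling the queue makes U the
supremum of a random walk in the past variables, so U, σ, τ are independent and the law of U does
not depend on n. Pathwise, customer n is in the middle iff both neighbours share its busy period,
which by Lindley's recursion means U ≥ 0 and τ ≤ U + σ (`inMiddle_iff`, `middleEvent_ae_eq`).

Integrating out τ, the transform of σ on this event is P(U ≥ 0) E[e^(-sσ)] - E[e^(-lam U); U ≥ 0]
E[e^(-(s+lam)σ)]. Only two numbers attached to U are needed, and stationarity yields them without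
the full law of U: the recursion gives a functional equation for the transform of max 0 U, whose one
unknown constant is fixed by letting the argument tend to 0
(`LindleyInvariant.integral_exp_neg_sojourn_eq`). -/

/-! ### Departure times and Lindley's recursion -/

/-- The time at which customer `n` departs if the server works without interruption from the arrival
of customer `n - j` on. -/
def arrivalLoad (A σ : ℤ → ℝ) (n : ℤ) (j : ℕ) : ℝ :=
  A (n - j) + ∑ i ∈ range (j + 1), σ (n - i)

/-- The defining recursion adds a last customer; equilibrium fixes the last customer and moves the
first, so a recursion at the other end is needed. The new term is the uninterrupted work from
customer `m` on. -/
theorem departureFrom_succ_eq_max (A σ : ℤ → ℝ) (m : ℤ) (k : ℕ) :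
    departureFrom A σ m (k + 1) =
      max (departureFrom A σ (m + 1) k) (A m + ∑ i ∈ range (k + 2), σ (m + i)) := by
  induction k with
  | zero =>
    simp [departureFrom, Finset.sum_range_succ, ← max_add_add_right, add_assoc]
  | succ k ih =>
    have e : m + ((k + 1 + 1 : ℕ) : ℤ) = m + 1 + ((k + 1 : ℕ) : ℤ) := by push_cast; ring
    rw [departureFrom, ih, departureFrom, e, sum_range_succ _ (k + 2), ← max_assoc,
      ← max_add_add_right]
    have e' : m + ((k + 2 : ℕ) : ℤ) = m + 1 + ((k + 1 : ℕ) : ℤ) := by push_cast; ring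
    rw [e', add_assoc (A m)]

theorem departureFrom_eq_partialSups (A σ : ℤ → ℝ) (n : ℤ) (k : ℕ) :
    departureFrom A σ (n - k) k = partialSups (arrivalLoad A σ n) k := by
  induction k with
  | zero => simp [departureFrom, arrivalLoad]
  | succ k ih =>
    rw [departureFrom_succ_eq_max, partialSups_add_one, ← ih, arrivalLoad]
    have e : n - ((k + 1 : ℕ) : ℤ) + 1 = n - k := by push_cast; ring
    rw [e, ← sum_range_reflect]
    congr 2
    refine sum_congr rfl fun i hi => congrArg σ ?_
    have := Finset.mem_range.1 hi
    omega

variable {A σ : ℤ → ℝ}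

/-- Boundedness matters because a real supremum takes a default value on unbounded sets; it holds
almost surely by stability. -/
theorem departure_eq_iSup_arrivalLoad {n : ℤ} (hb : BddAbove (Set.range (arrivalLoad A σ n))) :
    departure A σ n = ⨆ j, arrivalLoad A σ n j := by
  simp_rw [departure, departureFrom_eq_partialSups]
  exact ciSup_partialSups_eq hb

theorem arrivalLoad_succ (n : ℤ) (j : ℕ) :
    arrivalLoad A σ (n + 1) (j + 1) = arrivalLoad A σ n j + σ (n + 1) := by
  rw [arrivalLoad, arrivalLoad, sum_range_succ', ← add_assoc]
  simp

theorem bddAbove_arrivalLoad_succ {n : ℤ} (hb : BddAbove (Set.range (arrivalLoad A σ n))) :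
    BddAbove (Set.range (arrivalLoad A σ (n + 1))) := by
  obtain ⟨c, hc⟩ := hb
  refine ⟨max (arrivalLoad A σ (n + 1) 0) (c + σ (n + 1)), ?_⟩
  rintro _ ⟨j, rfl⟩
  cases j with
  | zero => exact le_max_left _ _
  | succ j =>
    rw [arrivalLoad_succ]
    have := hc ⟨j, rfl⟩
    exact le_max_of_le_right (by gcongr)

/-- Lindley's recursion. -/
theorem departure_succ {n : ℤ} (hb : BddAbove (Set.range (arrivalLoad A σ n))) :
    departure A σ (n + 1) = max (A (n + 1)) (departure A σ n) + σ (n + 1) := by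
  have hb' := bddAbove_arrivalLoad_succ hb
  rw [departure_eq_iSup_arrivalLoad hb', departure_eq_iSup_arrivalLoad hb, ← max_add_add_right]
  apply le_antisymm
  · refine ciSup_le fun j => ?_
    cases j with
    | zero => simp [arrivalLoad]
    | succ j =>
      rw [arrivalLoad_succ]
      exact le_max_of_le_right (by gcongr; exact le_ciSup hb j)
  · refine max_le ?_ ?_
    · refine le_trans (le_of_eq ?_) (le_ciSup hb' 0)
      simp [arrivalLoad]
    · rw [← le_sub_iff_add_le]
      refine ciSup_le fun j => ?_
      rw [le_sub_iff_add_le, ← arrivalLoad_succ]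
      exact le_ciSup hb' (j + 1)

theorem strictMono_departure (hσ : ∀ i, 0 < σ i)
    (hb : ∀ n, BddAbove (Set.range (arrivalLoad A σ n))) : StrictMono (departure A σ) := by
  refine strictMono_int_of_lt_succ fun n => ?_
  rw [departure_succ (hb n)]
  linarith [le_max_right (A (n + 1)) (departure A σ n), hσ (n + 1)]

theorem arrival_lt_departure (hσ : ∀ i, 0 < σ i)
    (hb : ∀ n, BddAbove (Set.range (arrivalLoad A σ n))) (n : ℤ) : A n < departure A σ n := by
  have h := departure_succ (hb (n - 1))
  rw [sub_add_cancel] at h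
  linarith [le_max_left (A n) (departure A σ (n - 1)), hσ n]

/-! ### Busy periods in terms of departures -/

theorem queueLength_pos_iff {t : ℝ} :
    0 < queueLength A σ t ↔ ∃ n, A n ≤ t ∧ t < departure A σ n := by
  simp [queueLength, Set.encard_pos, Set.Nonempty]

/-- If customer `n` leaves before the next arrival, the system is empty at that departure:
departures are ordered, so nobody earlier remains. In the case of equality the new arrival keeps the
queue length positive, hence `≤`. -/
theorem Icc_arrival_subset_iff (hA : StrictMono A) (hσ : ∀ i, 0 < σ i)
    (hb : ∀ n, BddAbove (Set.range (arrivalLoad A σ n))) (n : ℤ) :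
    Set.Icc (A n) (A (n + 1)) ⊆ {t | 0 < queueLength A σ t} ↔ A (n + 1) ≤ departure A σ n := by
  constructor
  · intro h
    by_contra! hlt
    obtain ⟨m, hm, hm'⟩ := queueLength_pos_iff.1
      (h ⟨(arrival_lt_departure hσ hb n).le, hlt.le⟩)
    have h1 : m < n + 1 := hA.lt_iff_lt.1 (hm.trans_lt hlt)
    have h2 : n < m := (strictMono_departure hσ hb).lt_iff_lt.1 hm'
    omega
  · rintro h t ⟨ht, ht'⟩
    refine queueLength_pos_iff.2 ?_
    rcases ht'.lt_or_eq with hlt | rfl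
    · exact ⟨n, ht, hlt.trans_le h⟩
    · exact ⟨n + 1, le_rfl, arrival_lt_departure hσ hb _⟩

theorem self_mem_busyCustomers (hσ : ∀ i, 0 < σ i)
    (hb : ∀ n, BddAbove (Set.range (arrivalLoad A σ n))) (n : ℤ) : n ∈ busyCustomers A σ n := by
  simp only [busyCustomers, busyPeriod, Set.mem_ofPred_eq, Set.mem_ordConnectedComponent,
    Set.uIcc_self, Set.singleton_subset_iff]
  exact queueLength_pos_iff.2 ⟨n, le_rfl, arrival_lt_departure hσ hb _⟩

/-- A busy period is an interval, so it contains the arrival of the predecessor as soon as it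
contains any earlier one. -/
theorem not_isLeast_busyCustomers_iff (hA : StrictMono A) (hσ : ∀ i, 0 < σ i)
    (hb : ∀ n, BddAbove (Set.range (arrivalLoad A σ n))) (n : ℤ) :
    ¬ IsLeast (busyCustomers A σ n) n ↔ n - 1 ∈ busyCustomers A σ n := by
  constructor
  · intro h
    have : ¬ n ∈ lowerBounds (busyCustomers A σ n) :=
      fun h' => h ⟨self_mem_busyCustomers hσ hb n, h'⟩
    simp only [mem_lowerBounds, not_forall, not_le] at this
    obtain ⟨m, hm, hmn⟩ := this
    refine Set.Subset.trans ?_ (show Set.uIcc (A n) (A m) ⊆ _ from hm)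
    show Set.uIcc _ _ ⊆ _
    rw [Set.uIcc_of_ge (hA.monotone (by omega)), Set.uIcc_of_ge (hA.monotone hmn.le)]
    exact Set.Icc_subset_Icc_left (hA.monotone (by omega))
  · intro h h'
    have := h'.2 h
    omega

theorem not_isGreatest_busyCustomers_iff (hA : StrictMono A) (hσ : ∀ i, 0 < σ i)
    (hb : ∀ n, BddAbove (Set.range (arrivalLoad A σ n))) (n : ℤ) :
    ¬ IsGreatest (busyCustomers A σ n) n ↔ n + 1 ∈ busyCustomers A σ n := by
  constructor
  · intro h
    have : ¬ n ∈ upperBounds (busyCustomers A σ n) :=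
      fun h' => h ⟨self_mem_busyCustomers hσ hb n, h'⟩
    simp only [mem_upperBounds, not_forall, not_le] at this
    obtain ⟨m, hm, hmn⟩ := this
    refine Set.Subset.trans ?_ (show Set.uIcc (A n) (A m) ⊆ _ from hm)
    show Set.uIcc _ _ ⊆ _
    rw [Set.uIcc_of_le (hA.monotone (by omega)), Set.uIcc_of_le (hA.monotone hmn.le)]
    exact Set.Icc_subset_Icc_right (hA.monotone (by omega))
  · intro h h'
    have := h'.2 h
    omega

theorem inMiddle_iff (hA : StrictMono A) (hσ : ∀ i, 0 < σ i)
    (hb : ∀ n, BddAbove (Set.range (arrivalLoad A σ n))) (n : ℤ) :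
    InMiddle A σ n ↔ A n ≤ departure A σ (n - 1) ∧ A (n + 1) ≤ departure A σ n := by
  have hpred := Icc_arrival_subset_iff hA hσ hb (n - 1)
  rw [sub_add_cancel] at hpred
  rw [InMiddle, not_isLeast_busyCustomers_iff hA hσ hb, not_isGreatest_busyCustomers_iff hA hσ hb,
    ← Icc_arrival_subset_iff hA hσ hb n, ← hpred,
    ← Set.uIcc_of_ge (hA.monotone (by omega : n - 1 ≤ n)),
    ← Set.uIcc_of_le (hA.monotone (by omega : n ≤ n + 1))]
  -- The size condition is automatic: both neighbours and `n` itself are three customers.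
  refine ⟨fun h => h.2, fun h => ⟨?_, h⟩⟩
  have hsub : ({n - 1, n, n + 1} : Set ℤ) ⊆ busyCustomers A σ n := by
    rintro m (rfl | rfl | rfl)
    exacts [h.1, self_mem_busyCustomers hσ hb _, h.2]
  have hcard : ({n - 1, n, n + 1} : Set ℤ).encard = 3 :=
    Set.encard_eq_three.2 ⟨n - 1, n, n + 1, by omega, by omega, by omega, rfl⟩
  calc (2 : ℕ∞) < 3 := by norm_num
    _ = _ := hcard.symm
    _ ≤ _ := Set.encard_le_encard hsub

/-! ### Integrals against the exponential law -/

theorem expMeasure_eq_withDensity (r : ℝ) :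
    expMeasure r = (volume.restrict (Set.Ioi 0)).withDensity
      (fun x => ENNReal.ofReal (r * Real.exp (-(r * x)))) := by
  have h : exponentialPDF r =ᵐ[volume] (Set.Ioi (0 : ℝ)).indicator
      (fun x => ENNReal.ofReal (r * Real.exp (-(r * x)))) := by
    have h0 : ∀ᵐ x : ℝ ∂volume, x ≠ 0 := by simp [ae_iff]
    filter_upwards [h0] with x hx
    rcases lt_or_gt_of_ne hx with h | h
    · rw [exponentialPDF_of_neg h, Set.indicator_of_notMem (by simp [h.le])]
    · rw [exponentialPDF_of_nonneg h.le, Set.indicator_of_mem (by simpa using h)]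
  change volume.withDensity (exponentialPDF r) = _
  rw [withDensity_congr_ae h, withDensity_indicator measurableSet_Ioi]

theorem integral_expMeasure_restrict {E : Type*} [NormedAddCommGroup E] [NormedSpace ℝ E]
    {r c : ℝ} (hr : 0 < r) (hc : 0 ≤ c) (f : ℝ → E) :
    ∫ x in Set.Ioi c, f x ∂(expMeasure r) =
      ∫ x in Set.Ioi c, (r * Real.exp (-(r * x))) • f x := by
  rw [expMeasure_eq_withDensity r, restrict_withDensity measurableSet_Ioi,
    Measure.restrict_restrict measurableSet_Ioi,
    Set.inter_eq_left.2 (Set.Ioi_subset_Ioi hc),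
    integral_withDensity_eq_integral_toReal_smul (by fun_prop) (by simp)]
  refine integral_congr_ae (.of_forall fun x => ?_)
  simp only
  rw [ENNReal.toReal_ofReal (by positivity)]

theorem ae_expMeasure_pos (r : ℝ) : ∀ᵐ x ∂(expMeasure r), 0 < x := by
  rw [expMeasure_eq_withDensity r]
  exact (withDensity_absolutelyContinuous _ _).ae_le (ae_restrict_mem measurableSet_Ioi)

theorem integral_expMeasure {E : Type*} [NormedAddCommGroup E] [NormedSpace ℝ E]
    {r : ℝ} (hr : 0 < r) (f : ℝ → E) :
    ∫ x, f x ∂(expMeasure r) = ∫ x in Set.Ioi 0, (r * Real.exp (-(r * x))) • f x := by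
  rw [← integral_expMeasure_restrict hr le_rfl, Measure.restrict_eq_self_of_ae_mem]
  simpa using ae_expMeasure_pos r

theorem setIntegral_cexp_expMeasure {r c : ℝ} (hr : 0 < r) (hc : 0 ≤ c) {a : ℂ} (ha : a.re < r) :
    ∫ x in Set.Ioi c, Complex.exp (a * x) ∂(expMeasure r) =
      r / (r - a) * Complex.exp (-((r - a) * c)) := by
  rw [integral_expMeasure_restrict hr hc]
  have h (x : ℝ) : (r * Real.exp (-(r * x))) • Complex.exp (a * x) =
      r * Complex.exp ((a - r) * x) := by
    rw [Complex.real_smul]; push_cast; rw [mul_assoc, ← Complex.exp_add]; congr 2; ring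
  simp_rw [h]
  have hne : (r : ℂ) - a ≠ 0 := fun h0 => by
    have := congrArg Complex.re h0
    simp at this; linarith
  rw [integral_const_mul, integral_exp_mul_complex_Ioi (by simpa using ha)]
  have hne' : a - r ≠ 0 := by rw [← neg_sub]; exact neg_ne_zero.2 hne
  rw [show (a - r) * (c : ℂ) = -((r - a) * c) by ring]
  field_simp
  ring

theorem integral_cexp_expMeasure {r : ℝ} (hr : 0 < r) {a : ℂ} (ha : a.re < r) :
    ∫ x, Complex.exp (a * x) ∂(expMeasure r) = r / (r - a) := by
  rw [← Measure.restrict_eq_self_of_ae_mem (s := Set.Ioi 0) (ae_expMeasure_pos r),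
    setIntegral_cexp_expMeasure hr le_rfl ha]
  simp

theorem setIntegral_exp_expMeasure {r c a : ℝ} (hr : 0 < r) (hc : 0 ≤ c) (ha : a < r) :
    ∫ x in Set.Ioi c, Real.exp (a * x) ∂(expMeasure r) =
      r / (r - a) * Real.exp (-((r - a) * c)) := by
  have := setIntegral_cexp_expMeasure hr hc (a := a) (by simpa using ha)
  rw [← Complex.ofReal_inj, ← integral_complex_ofReal]
  push_cast
  exact this

theorem integral_exp_expMeasure {r a : ℝ} (hr : 0 < r) (ha : a < r) :
    ∫ x, Real.exp (a * x) ∂(expMeasure r) = r / (r - a) := by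
  have := integral_cexp_expMeasure hr (a := a) (by simpa using ha)
  rw [← Complex.ofReal_inj, ← integral_complex_ofReal]
  push_cast
  exact this

theorem integrable_exp_expMeasure {r a : ℝ} (hr : 0 < r) (ha : a < r) :
    Integrable (fun x => Real.exp (a * x)) (expMeasure r) := by
  -- A non-integrable function has Bochner integral 0, so a nonzero value proves integrability.
  refine .of_integral_ne_zero ?_
  rw [integral_exp_expMeasure hr ha]
  have : 0 < r - a := by linarith
  positivity

theorem integral_id_expMeasure {r : ℝ} (hr : 0 < r) : ∫ x, x ∂(expMeasure r) = 1 / r := by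
  have h := Real.integral_rpow_mul_exp_neg_mul_Ioi (a := 2) two_pos hr
  rw [integral_expMeasure hr]
  have e (x : ℝ) : (r * Real.exp (-(r * x))) • x =
      r * (x ^ ((2 : ℝ) - 1) * Real.exp (-(r * x))) := by
    norm_num; ring
  simp_rw [e]
  rw [integral_const_mul, h, Real.Gamma_two]
  norm_num
  field_simp

theorem integrable_id_expMeasure {r : ℝ} (hr : 0 < r) :
    Integrable (fun x => x) (expMeasure r) :=
  .of_integral_ne_zero (by rw [integral_id_expMeasure hr]; positivity)

theorem measureReal_Ioi_expMeasure {r c : ℝ} (hr : 0 < r) (hc : 0 ≤ c) :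
    (expMeasure r).real (Set.Ioi c) = Real.exp (-(r * c)) := by
  have := setIntegral_exp_expMeasure hr hc (a := 0) hr
  simpa [hr.ne'] using this

/-- The Laplace transform of the positive part of `x - τ`, for `τ` exponential. -/
theorem integral_exp_neg_max_expMeasure {r x θ : ℝ} (hr : 0 < r) (hx : 0 ≤ x) (hθ : θ < r) :
    ∫ t, Real.exp (-(θ * max 0 (x - t))) ∂(expMeasure r) =
      r / (r - θ) * Real.exp (-(θ * x)) - θ / (r - θ) * Real.exp (-(r * x)) := by
  have := isProbabilityMeasure_expMeasure hr
  have hint : Integrable (fun t => Real.exp (-(θ * x)) * Real.exp (θ * t)) (expMeasure r) :=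
    (integrable_exp_expMeasure hr hθ).const_mul _
  have hint' : Integrable (fun t => 1 - Real.exp (-(θ * x)) * Real.exp (θ * t)) (expMeasure r) :=
    (integrable_const 1).sub hint
  -- Drop the positive part everywhere and correct on `t > x`; `θ < r` makes the uncorrected
  -- exponential integrable.
  have e (t : ℝ) : Real.exp (-(θ * max 0 (x - t))) = Real.exp (-(θ * x)) * Real.exp (θ * t) +
      (Set.Ioi x).indicator (fun t => 1 - Real.exp (-(θ * x)) * Real.exp (θ * t)) t := by
    by_cases h : x < t
    · rw [Set.indicator_of_mem (by simpa using h), max_eq_left (by linarith)]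
      simp
    · rw [Set.indicator_of_notMem (by simpa using h), max_eq_right (by linarith),
        ← Real.exp_add, add_zero]
      congr 1; ring
  simp_rw [e]
  rw [integral_add hint (hint'.indicator measurableSet_Ioi),
    integral_indicator measurableSet_Ioi, integral_sub (integrable_const _) hint.restrict,
    integral_const_mul, integral_const_mul, integral_exp_expMeasure hr hθ,
    setIntegral_exp_expMeasure hr hx hθ]
  simp only [integral_const, smul_eq_mul, mul_one, measureReal_restrict_apply_univ]
  rw [measureReal_Ioi_expMeasure hr hx]
  have h1 : Real.exp (-(r * x)) = Real.exp (-(θ * x)) * Real.exp (-((r - θ) * x)) := by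
    rw [← Real.exp_add]; congr 1; ring
  have h2 : r - θ ≠ 0 := by linarith
  rw [h1]
  field_simp
  ring

/-! ### Consequences of stationarity -/

open Filter Topology

/-- The law `κ` of `U` is invariant under the Lindley step `U ↦ max 0 U + σ - τ`, where
`σ ~ Exp(mu)` and `τ ~ Exp(lam)` are independent of each other and of `U`. -/
def LindleyInvariant (lam mu : ℝ) (κ : Measure ℝ) : Prop :=
  ((κ.prod (expMeasure mu)).prod (expMeasure lam)).map
    (fun p => max 0 p.1.1 + p.1.2 - p.2) = κ

section

variable {lam mu : ℝ} {κ : Measure ℝ}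

theorem ae_prod_expMeasure_pos (hmu : 0 < mu) :
    ∀ᵐ p ∂(κ.prod (expMeasure mu)), 0 < p.2 := by
  have := isProbabilityMeasure_expMeasure hmu
  exact Measure.quasiMeasurePreserving_snd.ae (ae_expMeasure_pos mu)

variable [IsProbabilityMeasure κ]

theorem integral_exp_neg_sojourn (hmu : 0 < mu) {θ : ℝ} (hθ : 0 ≤ θ) :
    ∫ p, Real.exp (-(θ * (max 0 p.1 + p.2))) ∂(κ.prod (expMeasure mu)) =
      (∫ u, Real.exp (-(θ * max 0 u)) ∂κ) * (mu / (mu + θ)) := by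
  have := isProbabilityMeasure_expMeasure hmu
  have e (p : ℝ × ℝ) : Real.exp (-(θ * (max 0 p.1 + p.2))) =
      Real.exp (-(θ * max 0 p.1)) * Real.exp ((-θ) * p.2) := by
    rw [← Real.exp_add]; congr 1; ring
  simp_rw [e]
  rw [integral_prod_mul (fun u => Real.exp (-(θ * max 0 u))) (fun s => Real.exp ((-θ) * s)),
    integral_exp_expMeasure hmu (by linarith), sub_neg_eq_add]

theorem integrable_exp_neg_sojourn (hmu : 0 < mu) {θ : ℝ} (hθ : 0 ≤ θ) :
    Integrable (fun p : ℝ × ℝ => Real.exp (-(θ * (max 0 p.1 + p.2))))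
      (κ.prod (expMeasure mu)) := by
  have := isProbabilityMeasure_expMeasure hmu
  refine .of_bound (by fun_prop) 1 ?_
  filter_upwards [ae_prod_expMeasure_pos hmu] with p hp
  rw [Real.norm_of_nonneg (Real.exp_pos _).le, Real.exp_le_one_iff, neg_nonpos]
  positivity

theorem integrable_exp_neg_waiting {θ : ℝ} (hθ : 0 ≤ θ) :
    Integrable (fun u => Real.exp (-(θ * max 0 u))) κ := by
  refine .of_bound (by fun_prop) 1 (.of_forall fun u => ?_)
  rw [Real.norm_of_nonneg (Real.exp_pos _).le, Real.exp_le_one_iff, neg_nonpos]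
  positivity

/-- The next waiting time is the positive part of sojourn time minus τ; integrating τ first leaves
sojourn transforms at `θ` and at `lam` only. -/
theorem LindleyInvariant.integral_exp_neg_waiting (hκ : LindleyInvariant lam mu κ)
    (hlam : 0 < lam) (hmu : 0 < mu) {θ : ℝ} (hθ : 0 ≤ θ) (hθ' : θ < lam) :
    ∫ u, Real.exp (-(θ * max 0 u)) ∂κ =
      lam / (lam - θ) * ∫ p, Real.exp (-(θ * (max 0 p.1 + p.2))) ∂(κ.prod (expMeasure mu)) -
      θ / (lam - θ) * ∫ p, Real.exp (-(lam * (max 0 p.1 + p.2))) ∂(κ.prod (expMeasure mu)) := by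
  have := isProbabilityMeasure_expMeasure hmu
  have := isProbabilityMeasure_expMeasure hlam
  conv_lhs => rw [← hκ]
  rw [integral_map (by fun_prop) (by fun_prop), integral_prod]
  · rw [← integral_const_mul, ← integral_const_mul,
      ← integral_sub ((integrable_exp_neg_sojourn hmu hθ).const_mul _)
        ((integrable_exp_neg_sojourn hmu hlam.le).const_mul _)]
    refine integral_congr_ae ?_
    filter_upwards [ae_prod_expMeasure_pos hmu] with p hp
    exact integral_exp_neg_max_expMeasure hlam (by positivity) hθ'
  · refine .of_bound (by fun_prop) 1 (.of_forall fun u => ?_)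
    rw [Real.norm_of_nonneg (Real.exp_pos _).le, Real.exp_le_one_iff, neg_nonpos]
    positivity

theorem tendsto_integral_exp_neg_waiting :
    Tendsto (fun θ => ∫ u, Real.exp (-(θ * max 0 u)) ∂κ) (𝓝[>] 0) (𝓝 1) := by
  have h : (1 : ℝ) = ∫ _, 1 ∂κ := by simp
  rw [h]
  refine tendsto_integral_filter_of_dominated_convergence (fun _ => 1)
    (.of_forall fun θ => by fun_prop) ?_ (integrable_const _) (.of_forall fun u => ?_)
  · filter_upwards [self_mem_nhdsWithin] with θ hθ
    refine .of_forall fun u => ?_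
    have : 0 < θ := hθ
    rw [Real.norm_of_nonneg (Real.exp_pos _).le, Real.exp_le_one_iff, neg_nonpos]
    positivity
  · refine tendsto_nhdsWithin_of_tendsto_nhds ?_
    have : Continuous fun θ : ℝ => Real.exp (-(θ * max 0 u)) := by fun_prop
    simpa using this.tendsto 0

/-- With φ the waiting-time transform and ψ this integral, the functional equation reduces to
φ(θ)(mu - lam + θ) = (mu + θ)ψ, and φ(θ) → 1 as θ → 0+. -/
theorem LindleyInvariant.integral_exp_neg_sojourn_eq (hκ : LindleyInvariant lam mu κ)
    (hlam : 0 < lam) (hmu : 0 < mu) :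
    ∫ p, Real.exp (-(lam * (max 0 p.1 + p.2))) ∂(κ.prod (expMeasure mu)) = (mu - lam) / mu := by
  set ψ := ∫ p, Real.exp (-(lam * (max 0 p.1 + p.2))) ∂(κ.prod (expMeasure mu)) with hψ
  have h1 : Tendsto (fun θ => (∫ u, Real.exp (-(θ * max 0 u)) ∂κ) * (mu - lam + θ)) (𝓝[>] 0)
      (𝓝 (1 * (mu - lam + 0))) :=
    tendsto_integral_exp_neg_waiting.mul
      (tendsto_nhdsWithin_of_tendsto_nhds (Continuous.tendsto (by fun_prop) 0))
  have h2 : Tendsto (fun θ => (mu + θ) * ψ) (𝓝[>] 0) (𝓝 ((mu + 0) * ψ)) :=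
    tendsto_nhdsWithin_of_tendsto_nhds (Continuous.tendsto (by fun_prop) 0)
  have h3 : (fun θ => (∫ u, Real.exp (-(θ * max 0 u)) ∂κ) * (mu - lam + θ)) =ᶠ[𝓝[>] 0]
      fun θ => (mu + θ) * ψ := by
    filter_upwards [Ioo_mem_nhdsGT hlam] with θ hθ
    have h := hκ.integral_exp_neg_waiting hlam hmu hθ.1.le hθ.2
    rw [← hψ, integral_exp_neg_sojourn hmu hθ.1.le] at h
    have n1 : lam - θ ≠ 0 := by linarith [hθ.2]
    have n2 : mu + θ ≠ 0 := by linarith [hθ.1]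
    have n3 : θ ≠ 0 := hθ.1.ne'
    generalize (∫ u, Real.exp (-(θ * max 0 u)) ∂κ) = φ at h ⊢
    field_simp at h
    -- The uncancelled equation carries a factor `θ` and is void at 0, hence the limit instead of an
    -- evaluation.
    refine mul_left_cancel₀ n3 ?_
    linear_combination -h
  have h4 := tendsto_nhds_unique (h1.congr' h3) h2
  rw [eq_div_iff hmu.ne']
  linarith

/-- By invariance U < 0 has the probability that τ exceeds the sojourn time, which is the
expectation of e^(-lam · sojourn). -/
theorem LindleyInvariant.measureReal_Iio (hκ : LindleyInvariant lam mu κ)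
    (hlam : 0 < lam) (hmu : 0 < mu) : κ.real (Set.Iio 0) = (mu - lam) / mu := by
  have := isProbabilityMeasure_expMeasure hmu
  have := isProbabilityMeasure_expMeasure hlam
  rw [← hκ.integral_exp_neg_sojourn_eq hlam hmu, ← integral_indicator_one measurableSet_Iio]
  conv_lhs => rw [← hκ]
  have hm : Measurable ((Set.Iio (0 : ℝ)).indicator (1 : ℝ → ℝ)) :=
    measurable_one.indicator measurableSet_Iio
  rw [integral_map (by fun_prop) hm.aestronglyMeasurable, integral_prod]
  · refine integral_congr_ae ?_
    filter_upwards [ae_prod_expMeasure_pos hmu] with p hp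
    rw [← measureReal_Ioi_expMeasure hlam (by positivity),
      ← integral_indicator_one measurableSet_Ioi]
    refine integral_congr_ae (.of_forall fun t => ?_)
    simp [Set.indicator_apply]
  · refine .of_bound (hm.comp (by fun_prop)).aestronglyMeasurable 1 (.of_forall fun p => ?_)
    exact (norm_indicator_le_norm_self _ _).trans (by simp)

theorem LindleyInvariant.measureReal_Ici (hκ : LindleyInvariant lam mu κ)
    (hlam : 0 < lam) (hmu : 0 < mu) : κ.real (Set.Ici 0) = lam / mu := by
  rw [← Set.compl_Iio, probReal_compl_eq_one_sub measurableSet_Iio,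
    hκ.measureReal_Iio hlam hmu]
  field_simp
  ring

/-- Dividing the sojourn transform at `lam` by that of the service gives the waiting transform; the
part with U < 0, where the waiting time is 0, contributes P(U < 0) and is subtracted. -/
theorem LindleyInvariant.setIntegral_exp_neg (hκ : LindleyInvariant lam mu κ)
    (hlam : 0 < lam) (hmu : 0 < mu) :
    ∫ u in Set.Ici 0, Real.exp (-(lam * u)) ∂κ = lam * (mu - lam) / mu ^ 2 := by
  have hφ := integral_exp_neg_sojourn (κ := κ) hmu hlam.le
  rw [hκ.integral_exp_neg_sojourn_eq hlam hmu] at hφ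
  have hsplit := integral_add_compl (measurableSet_Ici (a := (0 : ℝ)))
    (integrable_exp_neg_waiting (κ := κ) hlam.le)
  have h1 : ∫ u in Set.Ici 0, Real.exp (-(lam * max 0 u)) ∂κ =
      ∫ u in Set.Ici 0, Real.exp (-(lam * u)) ∂κ :=
    setIntegral_congr_fun measurableSet_Ici fun u hu => by
      simp only [max_eq_right (Set.mem_Ici.1 hu)]
  have h2 : ∫ u in (Set.Ici 0)ᶜ, Real.exp (-(lam * max 0 u)) ∂κ = (mu - lam) / mu := by
    rw [Set.compl_Ici, ← hκ.measureReal_Iio hlam hmu,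
      setIntegral_congr_fun (g := fun _ => (1 : ℝ)) measurableSet_Iio fun u hu => by
        simp [max_eq_left (Set.mem_Iio.1 hu).le]]
    simp
  rw [h1, h2] at hsplit
  rw [← hsplit] at hφ
  have : mu + lam ≠ 0 := by positivity
  field_simp at hφ ⊢
  linear_combination -hφ

/-! ### The transform on the middle event -/

/-- The values of `(U, σ, τ)` at which a customer is neither the first nor the last of its
busy period. -/
def middleSet : Set ((ℝ × ℝ) × ℝ) := {p | 0 ≤ p.1.1 ∧ p.2 ≤ p.1.1 + p.1.2}

theorem measurableSet_middleSet : MeasurableSet middleSet :=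
  have h1 : MeasurableSet {p : (ℝ × ℝ) × ℝ | 0 ≤ p.1.1} :=
    measurableSet_le (by fun_prop) (by fun_prop)
  have h2 : MeasurableSet {p : (ℝ × ℝ) × ℝ | p.2 ≤ p.1.1 + p.1.2} :=
    measurableSet_le (by fun_prop) (by fun_prop)
  h1.inter h2

theorem LindleyInvariant.setIntegral_middleSet (hκ : LindleyInvariant lam mu κ)
    (hlam : 0 < lam) (hmu : 0 < mu) {s : ℂ} (hs : 0 ≤ s.re) :
    ∫ p in middleSet, Complex.exp (-s * (p.1.2 : ℂ))
        ∂((κ.prod (expMeasure mu)).prod (expMeasure lam)) =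
      lam / mu * (lam * (2 * mu + s) / ((mu + s) * (mu + lam + s))) := by
  have := isProbabilityMeasure_expMeasure hmu
  have := isProbabilityMeasure_expMeasure hlam
  have hmeas : Measurable fun p : (ℝ × ℝ) × ℝ => Complex.exp (-s * (p.1.2 : ℂ)) := by fun_prop
  rw [← integral_indicator measurableSet_middleSet, integral_prod]
  -- P(τ ≤ u + x) = 1 - e^(-lam u) e^(-lam x) splits into products, so U and σ separate.
  · have inner : ∀ᵐ p ∂(κ.prod (expMeasure mu)),
        ∫ t, middleSet.indicator (fun p => Complex.exp (-s * (p.1.2 : ℂ))) (p, t)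
          ∂(expMeasure lam) =
        (Set.Ici 0).indicator (fun _ => (1 : ℂ)) p.1 * Complex.exp (-s * (p.2 : ℂ)) -
        (Set.Ici 0).indicator (fun u : ℝ => (Real.exp (-(lam * u)) : ℂ)) p.1 *
          Complex.exp (-(s + lam) * (p.2 : ℂ)) := by
      filter_upwards [ae_prod_expMeasure_pos hmu] with p hp
      by_cases hu : 0 ≤ p.1
      · have e (t : ℝ) : middleSet.indicator (fun p => Complex.exp (-s * (p.1.2 : ℂ))) (p, t) =
            (Set.Ioi (p.1 + p.2))ᶜ.indicator (fun _ => Complex.exp (-s * (p.2 : ℂ))) t := by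
          simp [Set.indicator_apply, middleSet, hu]
        simp_rw [e]
        rw [integral_indicator measurableSet_Ioi.compl, setIntegral_const,
          probReal_compl_eq_one_sub measurableSet_Ioi,
          measureReal_Ioi_expMeasure hlam (by positivity),
          Set.indicator_of_mem (by simpa using hu), Set.indicator_of_mem (by simpa using hu),
          Complex.real_smul]
        push_cast
        rw [sub_mul, one_mul, ← Complex.exp_add, ← Complex.exp_add]
        congr 2
        ring
      · simp [middleSet, hu]
    rw [integral_congr_ae inner]
    have hint1 : Integrable (fun u : ℝ => (Set.Ici 0).indicator (fun _ => (1 : ℂ)) u) κ :=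
      (integrable_const _).indicator measurableSet_Ici
    have hint2 : Integrable (fun u : ℝ =>
        (Set.Ici 0).indicator (fun u : ℝ => (Real.exp (-(lam * u)) : ℂ)) u) κ := by
      refine .of_bound (Measurable.indicator (by fun_prop) measurableSet_Ici).aestronglyMeasurable
        1 (.of_forall fun u => ?_)
      by_cases hu : 0 ≤ u
      · rw [Set.indicator_of_mem (by simpa using hu), Complex.norm_real,
          Real.norm_of_nonneg (Real.exp_pos _).le, Real.exp_le_one_iff, neg_nonpos]
        positivity
      · simp [hu]
    have hint3 {z : ℂ} (hz : 0 ≤ z.re) :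
        Integrable (fun x : ℝ => Complex.exp (-z * (x : ℂ))) (expMeasure mu) := by
      refine .of_bound (by fun_prop) 1 ?_
      filter_upwards [ae_expMeasure_pos mu] with x hx
      rw [Complex.norm_exp, Real.exp_le_one_iff]
      simp
      positivity
    have hs' : 0 ≤ (s + lam).re := by simp; positivity
    have val {z : ℂ} (hz : 0 ≤ z.re) :
        ∫ x : ℝ, Complex.exp (-z * (x : ℂ)) ∂(expMeasure mu) = mu / (mu + z) := by
      rw [integral_cexp_expMeasure hmu (by simp; linarith), sub_neg_eq_add]
    rw [integral_sub (hint1.mul_prod (hint3 hs)) (hint2.mul_prod (hint3 hs')),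
      integral_prod_mul (fun u : ℝ => (Set.Ici 0).indicator (fun _ => (1 : ℂ)) u)
        (fun x : ℝ => Complex.exp (-s * (x : ℂ))),
      integral_prod_mul
        (fun u : ℝ => (Set.Ici 0).indicator (fun u : ℝ => (Real.exp (-(lam * u)) : ℂ)) u)
        (fun x : ℝ => Complex.exp (-(s + lam) * (x : ℂ))), val hs, val hs',
      integral_indicator measurableSet_Ici, integral_indicator measurableSet_Ici,
      integral_complex_ofReal, hκ.setIntegral_exp_neg hlam hmu, setIntegral_const,
      hκ.measureReal_Ici hlam hmu, Complex.real_smul]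
    have n0 : (mu : ℂ) ≠ 0 := by exact_mod_cast hmu.ne'
    have n1 : (mu : ℂ) + s ≠ 0 := fun h => by
      have := congrArg Complex.re h
      simp at this; linarith
    have n2 : (mu : ℂ) + lam + s ≠ 0 := fun h => by
      have := congrArg Complex.re h
      simp at this; linarith
    have n3 : (mu : ℂ) + (s + lam) ≠ 0 := by convert n2 using 1; ring
    push_cast
    field_simp
    ring
  · refine .of_bound (hmeas.indicator measurableSet_middleSet).aestronglyMeasurable 1 ?_
    have : ∀ᵐ p ∂((κ.prod (expMeasure mu)).prod (expMeasure lam)), 0 < p.1.2 :=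
      Measure.quasiMeasurePreserving_fst.ae (ae_prod_expMeasure_pos hmu)
    filter_upwards [this] with p hp
    refine (norm_indicator_le_norm_self _ _).trans ?_
    rw [Complex.norm_exp, Real.exp_le_one_iff]
    simp
    positivity

end

/-! ### The lag as a functional of the past -/

/-- The supremum over `j ≥ 1` of the random walk with steps `x (inr i) - x (inl i)`. -/
def walkSup (x : ℕ ⊕ ℕ → ℝ) : ℝ :=
  ⨆ j : ℕ, ∑ i ∈ Finset.range (j + 1), (x (.inr i) - x (.inl i))

theorem measurable_walkSup : Measurable walkSup :=
  .iSup fun _ => Finset.measurable_fun_sum _ fun _ _ =>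
    (measurable_pi_apply _).sub (measurable_pi_apply _)

/-- The indices of the interarrival and service times that precede the arrival of customer `n`. -/
def pastIndex (n : ℤ) : ℕ ⊕ ℕ → ℤ ⊕ ℤ :=
  Sum.map (fun i => n - 1 - (i : ℤ)) (fun i => n - 1 - (i : ℤ))

theorem pastIndex_injective (n : ℤ) : Function.Injective (pastIndex n) :=
  .sumMap (fun i j h => by simpa using h) (fun i j h => by simpa using h)

/-- The interarrival and service times. -/
def primitives {Ω : Type*} (A σ : ℤ → Ω → ℝ) : ℤ ⊕ ℤ → Ω → ℝ :=
  Sum.elim (fun n ω => A (n + 1) ω - A n ω) σ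

/-- A version of the difference between the departure time of customer `n - 1` and the arrival time
of customer `n`. -/
def lag {Ω : Type*} (A σ : ℤ → Ω → ℝ) (n : ℤ) (ω : Ω) : ℝ :=
  walkSup fun z => primitives A σ (pastIndex n z) ω

theorem arrivalLoad_eq_add_sum (A σ : ℤ → ℝ) (n : ℤ) (j : ℕ) :
    arrivalLoad A σ (n - 1) j = A n +
      ∑ i ∈ Finset.range (j + 1), (σ (n - 1 - i) - (A (n - 1 - i + 1) - A (n - 1 - i))) := by
  have h := Finset.sum_range_sub' (fun i : ℕ => A (n - i)) (j + 1)
  have e : ∑ i ∈ Finset.range (j + 1), (A (n - 1 - i + 1) - A (n - 1 - i)) =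
      ∑ i ∈ Finset.range (j + 1), (A (n - (i : ℕ)) - A (n - (i + 1 : ℕ))) := by
    refine Finset.sum_congr rfl fun i _ => ?_
    congr 2 <;> push_cast <;> ring
  rw [arrivalLoad, Finset.sum_sub_distrib, e, h]
  have e' : n - ((j + 1 : ℕ) : ℤ) = n - 1 - j := by push_cast; ring
  rw [e']
  simp
  ring

/-- The lag is defined from the primitive variables so that its law and independence are visible;
here it is matched with the queue by telescoping the interarrival times. -/
theorem lag_eq {Ω : Type*} {A σ : ℤ → Ω → ℝ} {n : ℤ} {ω : Ω}
    (hb : BddAbove (Set.range (arrivalLoad (A · ω) (σ · ω) (n - 1)))) :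
    lag A σ n ω = departure (A · ω) (σ · ω) (n - 1) - A n ω := by
  rw [departure_eq_iSup_arrivalLoad hb, eq_sub_iff_add_eq, add_comm]
  have h := (OrderIso.addLeft (A n ω)).map_ciSup
    (f := fun j : ℕ => ∑ i ∈ Finset.range (j + 1), (σ (n - 1 - i) ω -
      (A (n - 1 - i + 1) ω - A (n - 1 - i) ω))) ?_
  · simp only [OrderIso.addLeft_apply] at h
    simp_rw [arrivalLoad_eq_add_sum]
    exact h
  · obtain ⟨c, hc⟩ := hb
    refine ⟨c - A n ω, ?_⟩
    rintro _ ⟨j, rfl⟩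
    have := hc ⟨j, rfl⟩
    rw [arrivalLoad_eq_add_sum] at this
    simp only
    linarith

theorem bddAbove_of_tendsto_div {u : ℕ → ℝ} {c : ℝ} (hc : c < 0)
    (h : Tendsto (fun m => u m / m) atTop (𝓝 c)) : BddAbove (Set.range u) := by
  refine (isBoundedUnder_of_eventually_le (a := 0) ?_).bddAbove_range
  filter_upwards [h.eventually_lt_const hc, eventually_gt_atTop 0] with m hm hm0
  have : (0 : ℝ) < m := by exact_mod_cast hm0
  rw [div_lt_iff₀ this, zero_mul] at hm
  exact hm.le

theorem measurable_iSup_comap {Ω ι : Type*} (X : ι → Ω → ℝ) {S : Set ι} {i : ι} (hi : i ∈ S) :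
    Measurable[⨆ i ∈ S, MeasurableSpace.comap (X i) inferInstance] (X i) :=
  (comap_measurable (X i)).mono
    (le_iSup₂_of_le (f := fun i (_ : i ∈ S) => MeasurableSpace.comap (X i) inferInstance)
      i hi le_rfl) le_rfl

/-! ### Laws, independence and stability -/

section

variable {Ω : Type*} [MeasurableSpace Ω] {P : Measure Ω}

/-- The strong law of large numbers for a sequence of exponential variables. -/
theorem ae_tendsto_sum_div_of_exp {r : ℝ} (hr : 0 < r) {X : ℕ → Ω → ℝ}
    (hX : ∀ i, Measurable (X i)) (hlaw : ∀ i, P.map (X i) = expMeasure r)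
    (hind : Pairwise fun i j => IndepFun (X i) (X j) P) :
    ∀ᵐ ω ∂P, Tendsto (fun m : ℕ => (∑ i ∈ Finset.range m, X i ω) / m) atTop (𝓝 (1 / r)) := by
  have hmean : ∫ ω, X 0 ω ∂P = 1 / r := by
    rw [← integral_id_expMeasure hr, ← hlaw 0, integral_map (hX 0).aemeasurable (by fun_prop)]
  have hint : Integrable (X 0) P := by
    have := integrable_id_expMeasure hr
    rw [← hlaw 0] at this
    exact this.comp_measurable (hX 0)
  rw [← hmean]
  exact strong_law_ae_real X hint hind fun i =>
    ⟨(hX i).aemeasurable, (hX 0).aemeasurable, by rw [hlaw, hlaw]⟩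

/-- Functions of disjoint groups of independent random variables are independent. -/
theorem indepFun_of_measurable_iSup {ι β γ : Type*} [MeasurableSpace β] [MeasurableSpace γ]
    {X : ι → Ω → ℝ} (hX : ∀ i, Measurable (X i)) (hind : iIndepFun X P) {S T : Set ι}
    (hST : Disjoint S T) {f : Ω → β} {g : Ω → γ}
    (hf : Measurable[⨆ i ∈ S, MeasurableSpace.comap (X i) inferInstance] f)
    (hg : Measurable[⨆ i ∈ T, MeasurableSpace.comap (X i) inferInstance] g) :
    IndepFun f g P := by
  have h := indep_iSup_of_disjoint (fun i => (hX i).comap_le) hind hST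
  exact indep_of_indep_of_le_left (indep_of_indep_of_le_right h hg.comap_le) hf.comap_le

variable {lam mu : ℝ} {A σ : ℤ → Ω → ℝ}

namespace IsMM1

theorem measurable_primitives (hQ : IsMM1 P lam mu A σ) (z : ℤ ⊕ ℤ) :
    Measurable (primitives A σ z) := by
  cases z with
  | inl n => exact (hQ.measurable_arrival _).sub (hQ.measurable_arrival _)
  | inr n => exact hQ.measurable_service n

theorem measurable_lag (hQ : IsMM1 P lam mu A σ) (n : ℤ) : Measurable (lag A σ n) :=
  measurable_walkSup.comp (measurable_pi_iff.2 fun _ => hQ.measurable_primitives _)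

theorem ae_primitives_pos (hQ : IsMM1 P lam mu A σ) :
    ∀ᵐ ω ∂P, ∀ z, 0 < primitives A σ z ω := by
  refine ae_all_iff.2 fun z => ?_
  have hz := (hQ.measurable_primitives z).aemeasurable (μ := P)
  have : ∀ᵐ x ∂(P.map (primitives A σ z)), 0 < x := by
    cases z with
    | inl n =>
      rw [primitives, Sum.elim_inl, hQ.law_interarrival n]
      exact ae_expMeasure_pos lam
    | inr n =>
      rw [primitives, Sum.elim_inr, hQ.law_service n]
      exact ae_expMeasure_pos mu
  exact ae_of_ae_map hz this

/-- By the strong law the walk has drift 1/mu - 1/lam < 0, so it is eventually nonpositive. -/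
theorem ae_bddAbove_arrivalLoad (hQ : IsMM1 P lam mu A σ) (hlam : 0 < lam) (hstable : lam < mu) :
    ∀ᵐ ω ∂P, ∀ n, BddAbove (Set.range (arrivalLoad (A · ω) (σ · ω) n)) := by
  refine ae_all_iff.2 fun n => ?_
  obtain ⟨n, rfl⟩ : ∃ k, n = k - 1 := ⟨n + 1, by ring⟩
  have hs := ae_tendsto_sum_div_of_exp (P := P) (hlam.trans hstable)
    (X := fun i : ℕ => σ (n - 1 - i)) (fun i => hQ.measurable_service _)
    (fun i => hQ.law_service _)
    (fun i j hij => hQ.indep.indepFun (i := .inr (n - 1 - i)) (j := .inr (n - 1 - j))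
      (by simpa using hij))
  have ht := ae_tendsto_sum_div_of_exp (P := P) hlam
    (X := fun (i : ℕ) ω => A (n - 1 - i + 1) ω - A (n - 1 - i) ω)
    (fun i => hQ.measurable_primitives (.inl (n - 1 - i))) (fun i => hQ.law_interarrival _)
    (fun i j hij => hQ.indep.indepFun (i := .inl (n - 1 - i)) (j := .inl (n - 1 - j))
      (by simpa using hij))
  filter_upwards [hs, ht] with ω hsω htω
  have hlt : 1 / mu - 1 / lam < 0 := sub_neg.2 (one_div_lt_one_div_of_lt hlam hstable)
  have h := hsω.sub htω
  simp_rw [← sub_div, ← Finset.sum_sub_distrib] at h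
  obtain ⟨c, hc⟩ := bddAbove_of_tendsto_div hlt h
  refine ⟨A n ω + c, ?_⟩
  rintro _ ⟨j, rfl⟩
  rw [arrivalLoad_eq_add_sum (A · ω)]
  -- Load `j` involves `j + 1` steps of the walk.
  have := hc ⟨j + 1, rfl⟩
  gcongr

/-- The law of the lag does not depend on the customer. -/
theorem map_lag_eq [IsProbabilityMeasure P] (hQ : IsMM1 P lam mu A σ) (m n : ℤ) :
    P.map (lag A σ m) = P.map (lag A σ n) := by
  have hmeas (k : ℤ) : Measurable fun ω z => primitives A σ (pastIndex k z) ω :=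
    measurable_pi_iff.2 fun _ => hQ.measurable_primitives _
  have hlaw (k : ℤ) : P.map (fun ω z => primitives A σ (pastIndex k z) ω) =
      Measure.infinitePi (Sum.elim (fun _ => expMeasure lam) (fun _ => expMeasure mu)) := by
    have hind : iIndepFun (fun z => primitives A σ (pastIndex k z)) P :=
      hQ.indep.precomp (pastIndex_injective k)
    rw [(iIndepFun_iff_map_fun_eq_infinitePi_map fun _ => hQ.measurable_primitives _).1 hind]
    congr 1
    funext z
    cases z with
    | inl i => exact hQ.law_interarrival _
    | inr i => exact hQ.law_service _
  have h (k : ℤ) : P.map (lag A σ k) =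
      (P.map (fun ω z => primitives A σ (pastIndex k z) ω)).map walkSup :=
    (Measure.map_map measurable_walkSup (hmeas k)).symm
  rw [h, h, hlaw, hlaw]

/-- The lag, the service time and the following interarrival time are independent. -/
theorem map_lag_service_interarrival [IsProbabilityMeasure P] (hQ : IsMM1 P lam mu A σ) (n : ℤ) :
    P.map (fun ω => ((lag A σ n ω, σ n ω), A (n + 1) ω - A n ω)) =
      ((P.map (lag A σ n)).prod (expMeasure mu)).prod (expMeasure lam) := by
  have hlag {S : Set (ℤ ⊕ ℤ)} (hS : Set.range (pastIndex n) ⊆ S) :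
      Measurable[⨆ i ∈ S, MeasurableSpace.comap (primitives A σ i) inferInstance] (lag A σ n) :=
    measurable_walkSup.comp (@measurable_pi_lambda _ _ _ (_) _ _ fun z =>
      measurable_iSup_comap (primitives A σ) (hS ⟨z, rfl⟩))
  have hσ {S : Set (ℤ ⊕ ℤ)} (hS : .inr n ∈ S) :
      Measurable[⨆ i ∈ S, MeasurableSpace.comap (primitives A σ i) inferInstance] (σ n) :=
    measurable_iSup_comap (primitives A σ) (i := .inr n) hS
  have h1 : IndepFun (lag A σ n) (σ n) P := by
    refine indepFun_of_measurable_iSup hQ.measurable_primitives hQ.indep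
      (S := Set.range (pastIndex n)) (T := {.inr n}) ?_ (hlag subset_rfl) (hσ rfl)
    rw [Set.disjoint_singleton_right]
    rintro ⟨i | i, hi⟩
    · simp [pastIndex] at hi
    · simp only [pastIndex, Sum.map_inr, Sum.inr.injEq] at hi
      omega
  have h2 : IndepFun (fun ω => (lag A σ n ω, σ n ω)) (fun ω => A (n + 1) ω - A n ω) P := by
    refine indepFun_of_measurable_iSup hQ.measurable_primitives hQ.indep
      (S := Set.range (pastIndex n) ∪ {.inr n}) (T := {.inl n}) ?_
      (@Measurable.prodMk _ _ _ _ _ (_) _ _ (hlag Set.subset_union_left) (hσ (by simp)))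
      (measurable_iSup_comap (primitives A σ) (i := .inl n) rfl)
    rw [Set.disjoint_singleton_right]
    rintro (⟨i | i, hi⟩ | hi)
    · simp only [pastIndex, Sum.map_inl, Sum.inl.injEq] at hi
      omega
    · simp [pastIndex] at hi
    · simp at hi
  have hm1 := (hQ.measurable_lag n).aemeasurable (μ := P)
  have hm2 := (hQ.measurable_service n).aemeasurable (μ := P)
  have hm3 := (hQ.measurable_primitives (.inl n)).aemeasurable (μ := P)
  have e1 := (indepFun_iff_map_prod_eq_prod_map_map hm1 hm2).1 h1
  have e2 := (indepFun_iff_map_prod_eq_prod_map_map (hm1.prodMk hm2) hm3).1 h2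
  rw [e1, hQ.law_service] at e2
  exact e2.trans (congrArg _ (hQ.law_interarrival n))

theorem ae_lag_succ (hQ : IsMM1 P lam mu A σ) (hlam : 0 < lam) (hstable : lam < mu) (n : ℤ) :
    ∀ᵐ ω ∂P, lag A σ (n + 1) ω = max 0 (lag A σ n ω) + σ n ω - (A (n + 1) ω - A n ω) := by
  filter_upwards [hQ.ae_bddAbove_arrivalLoad hlam hstable] with ω hb
  have h := departure_succ (hb (n - 1))
  rw [sub_add_cancel] at h
  rw [lag_eq (hb _), lag_eq (hb _), add_sub_cancel_right, h,
    ← sub_self (A n ω), max_sub_sub_right]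
  ring

theorem lindleyInvariant_map_lag [IsProbabilityMeasure P] (hQ : IsMM1 P lam mu A σ)
    (hlam : 0 < lam) (hstable : lam < mu) (n : ℤ) :
    LindleyInvariant lam mu (P.map (lag A σ n)) := by
  have hmeas : Measurable fun ω => ((lag A σ n ω, σ n ω), A (n + 1) ω - A n ω) :=
    ((hQ.measurable_lag n).prodMk (hQ.measurable_service n)).prodMk
      (hQ.measurable_primitives (.inl n))
  rw [LindleyInvariant, ← hQ.map_lag_service_interarrival, Measure.map_map (by fun_prop) hmeas,
    hQ.map_lag_eq n (n + 1)]
  exact Measure.map_congr ((hQ.ae_lag_succ hlam hstable n).mono fun ω h => h.symm)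

theorem middleEvent_ae_eq (hQ : IsMM1 P lam mu A σ) (hlam : 0 < lam) (hstable : lam < mu)
    (n : ℤ) : middleEvent A σ n =ᵐ[P]
      (fun ω => ((lag A σ n ω, σ n ω), A (n + 1) ω - A n ω)) ⁻¹' middleSet := by
  filter_upwards [hQ.ae_bddAbove_arrivalLoad hlam hstable, hQ.ae_primitives_pos,
    hQ.ae_lag_succ hlam hstable n] with ω hb hpos hsucc
  have hA : StrictMono (A · ω) :=
    strictMono_int_of_lt_succ fun k => sub_pos.1 (hpos (.inl k))
  have h1 := lag_eq (hb (n - 1))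
  have h2 := lag_eq (hb (n + 1 - 1))
  rw [add_sub_cancel_right] at h2
  refine propext ((inMiddle_iff (σ := (σ · ω)) hA (fun k => hpos (.inr k)) hb n).trans ?_)
  change _ ↔ 0 ≤ lag A σ n ω ∧ A (n + 1) ω - A n ω ≤ lag A σ n ω + σ n ω
  rw [← sub_nonneg, ← h1]
  refine and_congr_right fun h => ?_
  rw [← sub_nonneg, ← h2, hsucc, max_eq_right h, sub_nonneg]

end IsMM1

end

end MM1

end

/-! ### The conditional Laplace transform -/

theorem mainTheorem6 {Ω : Type*} [MeasurableSpace Ω] (P : Measure Ω) [IsProbabilityMeasure P]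
    (lam mu : ℝ) (hlam : 0 < lam) (hstable : lam < mu)
    (A σ : ℤ → Ω → ℝ) (hQ : MM1.IsMM1 P lam mu A σ) (n : ℤ) :
    NullMeasurableSet (MM1.middleEvent A σ n) P ∧
    P (MM1.middleEvent A σ n) ≠ 0 ∧
    ∀ s : ℂ, 0 ≤ s.re →
      ∫ ω, Complex.exp (-s * (σ n ω : ℂ)) ∂(P[|MM1.middleEvent A σ n]) =
        ((2 * mu + s) * (mu + lam)) / (2 * (mu + s) * (mu + lam + s)) := by
  have hmu : 0 < mu := hlam.trans hstable
  set J := fun ω => ((MM1.lag A σ n ω, σ n ω), A (n + 1) ω - A n ω) with hJ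
  have hJm : Measurable J :=
    ((hQ.measurable_lag n).prodMk (hQ.measurable_service n)).prodMk
      (hQ.measurable_primitives (.inl n))
  have hE := hQ.middleEvent_ae_eq hlam hstable n
  have hEm : MeasurableSet (J ⁻¹' MM1.middleSet) := hJm MM1.measurableSet_middleSet
  have := Measure.isProbabilityMeasure_map (hQ.measurable_lag n).aemeasurable (μ := P)
  have key {s : ℂ} (hs : 0 ≤ s.re) :
      ∫ ω in MM1.middleEvent A σ n, Complex.exp (-s * (σ n ω : ℂ)) ∂P =
        lam / mu * (lam * (2 * mu + s) / ((mu + s) * (mu + lam + s))) := by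
    rw [setIntegral_congr_set hE,
      ← (hQ.lindleyInvariant_map_lag hlam hstable n).setIntegral_middleSet hlam hmu hs,
      ← hQ.map_lag_service_interarrival,
      setIntegral_map MM1.measurableSet_middleSet (by fun_prop) hJm.aemeasurable]
  -- The probability of the event is its unnormalised transform at `s = 0`.
  have hreal : P.real (MM1.middleEvent A σ n) = lam / mu * (2 * lam / (mu + lam)) := by
    have h := key (s := 0) le_rfl
    simp only [neg_zero, zero_mul, Complex.exp_zero, setIntegral_const, Complex.real_smul,
      mul_one, add_zero] at h
    rw [← Complex.ofReal_inj, h]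
    have : (mu : ℂ) ≠ 0 := by exact_mod_cast hmu.ne'
    push_cast
    field_simp
  have hpos : 0 < P.real (MM1.middleEvent A σ n) := by rw [hreal]; positivity
  refine ⟨hEm.nullMeasurableSet.congr hE.symm, fun h => ?_, fun s hs => ?_⟩
  · rw [measureReal_def, h] at hpos
    simp at hpos
  · rw [ProbabilityTheory.cond, integral_smul_measure, key hs, ENNReal.toReal_inv,
      ← measureReal_def, hreal, Complex.real_smul]
    have n0 : (mu : ℂ) ≠ 0 := by exact_mod_cast hmu.ne'
    have n1 : (lam : ℂ) ≠ 0 := by exact_mod_cast hlam.ne'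
    have n2 : (mu : ℂ) + lam ≠ 0 := by exact_mod_cast (add_pos hmu hlam).ne'
    push_cast
    field_simp
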